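/- **Setting.** Let $N\ge 1$, $0\le M<K$ be integers and let $\mathcal A$ be a finite alphabet with at least two symbols. Entropies are in units of $\log|\mathcal A|$. Messages $W_1,\dots,W_K$ are independent and uniformly distributed on $\mathcal A^L$, so $H(W_k)=L$, and each of $N$ non-communicating databases stores all of them. *Prefetching.* A prefetching vector $\mathbf m=(m_1,\dots,m_N)\in\mathbb Z_{\ge0}^N$ satisfies $\sum_n m_n\le M$. The user caches from database $n$ the messages with indices in a set $\mathbb H_n\subseteq[K]$, $|\mathbb H_n|=m_n$, the $\mathbb H_n$ being pairwise disjoint; $\mathbb H=\bigcup_n\mathbb H_n$, and $\mathcal W_{\mathbb H}=(W_i)_{i\in\mathbb H}$. Database $n$ knows only $\mathbb H_n$. *Retrieval.* The user wants $W_\theta$ for some $\theta\in[K]\setminus\mathbb H$. A scheme draws discrete queries $(Q_1^{[\theta,\mathbb H]},\dots,Q_N^{[\theta,\mathbb H]})$ from a joint law depending on $\theta$ and $(\mathbb H_1,\dots,\mathbb H_N)$, independently of the messages; database $n$ replies with $A_n^{[\theta,\mathbb H]}$, a deterministic function of $Q_n^{[\theta,\mathbb H]}$ and $W_1,\dots,W_K$.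 The scheme is *private* if for every $n$, all prefetched families $(\mathbb H_j)_j$, $(\mathbb H'_j)_j$ for $\mathbf m$ with $\mathbb H_n=\mathbb H_n'$, and all $\theta\notin\mathbb H$, $\theta'\notin\mathbb H'$, $$(Q_n^{[\theta,\mathbb H]},A_n^{[\theta,\mathbb H]},W_1,\dots,W_K,\mathbb H_n)\sim(Q_n^{[\theta',\mathbb H']},A_n^{[\theta',\mathbb H']},W_1,\dots,W_K,\mathbb H_n).$$ *Cost.* A number $d$ is an achievable normalized download cost for $\mathbf m$ if there are private schemes with message lengths $L\to\infty$ such that, uniformly in $(\mathbb H_j)_j$ and $\theta\notin\mathbb H$, $H(W_\theta\mid\mathcal W_{\mathbb H},Q_{1:N}^{[\theta,\mathbb H]},A_{1:N}^{[\theta,\mathbb H]})=o(L)$ and $\sum_{n=1}^N H(A_n^{[\theta,\mathbb H]})\le dL$. Let $D^*(\mathbf m)$ be the infimum of the achievable $d$ for $\mathbf m$, let $D^*=\inf\{D^*(\mathbf m):\sum_n m_n\le M\}$, and let the capacity $C$ be the supremum of the achievable rates $1/d$ over all $\mathbf m$ with $\sum_n m_n\le M$. **Theorem.** The optimal normalized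 download cost is $$D^*=1+\frac1N+\cdots+\frac1{N^{K-M-1}},$$ and $D^*(\mathbf m)$ has this same value for every prefetching vector $\mathbf m$ with $\sum_n m_n=M$. The capacity is $C=1/D^*$. For $N\ge2$, these values are $$D^*=\frac{1-(1/N)^{K-M}}{1-1/N},\qquad C=\frac{1-1/N}{1-(1/N)^{K-M}}.$$ -/

import Mathlib

open scoped ENNReal

namespace SideInfoPIR

noncomputable section

/-- Entropy, in units of `log b`, of a discrete distribution; all summands are nonnegative, so
the sum is meaningful (possibly `∞`) for every distribution. -/
def entropy (b : ℕ) {α : Type} (p : PMF α) : ℝ≥0∞ :=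
  ∑' a, ENNReal.ofReal (-((p a).toReal * Real.logb b (p a).toReal))

/-- Conditional entropy `H(X | Y) = ∑_{x,y} p(x,y) log (p(y) / p(x,y))`, in units of `log b`,
where `r` is the joint distribution of the pair `(X, Y)`; all summands are nonnegative. -/
def condEntropy (b : ℕ) {α β : Type} (r : PMF (α × β)) : ℝ≥0∞ :=
  ∑' z : α × β, ENNReal.ofReal
    ((r z).toReal * Real.logb b (((r.map Prod.snd) z.2).toReal / (r z).toReal))

/-- The contents of the `K` messages, each made of `L` symbols of the alphabet `A`. -/
abbrev Messages (K L : ℕ) (A : Type) : Type := Fin K → Fin L → A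

/-- The outcome of a prefetching phase with prefetching vector `m`: the sets `cached n` of indices
of the messages cached from the databases `n`. They are pairwise disjoint and `cached n` has
`m n` elements. -/
structure Prefetch (N K : ℕ) (m : Fin N → ℕ) where
  cached : Fin N → Finset (Fin K)
  card_cached : ∀ n, (cached n).card = m n
  pairwise_disjoint : ∀ n₁ n₂, n₁ ≠ n₂ → Disjoint (cached n₁) (cached n₂)

/-- The set of the indices of all cached messages. -/
def Prefetch.all {N K : ℕ} {m : Fin N → ℕ} (H : Prefetch N K m) : Finset (Fin K) :=
  Finset.univ.biUnion H.cached

/-- A retrieval scheme. For the desired index `θ` and the prefetched indices `H` the user draws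
the `N` queries jointly from `queryLaw θ H`, independently of the messages; database `n` answers
deterministically, from its query and the messages. (`queryLaw θ H` is only ever used
for `θ ∉ H.all`.) -/
structure Scheme (N K : ℕ) (m : Fin N → ℕ) (A : Type) (L : ℕ) where
  Query : Fin N → Type
  Answer : Fin N → Type
  queryLaw : Fin K → Prefetch N K m → PMF (∀ n, Query n)
  answer : ∀ n, Query n → Messages K L A → Answer n

namespace Scheme

variable {N K : ℕ} {m : Fin N → ℕ} {A : Type} [Fintype A] [Nonempty A] {L : ℕ}

/-- The joint law of the messages and the queries: the messages are independent and uniformly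
distributed, and they are independent of the queries. -/
def joint (S : Scheme N K m A L) (θ : Fin K) (H : Prefetch N K m) :
    PMF (Messages K L A × (∀ n, S.Query n)) :=
  (PMF.uniformOfFintype (Messages K L A)).bind fun w => (S.queryLaw θ H).map fun Q => (w, Q)

/-- The law of what database `n` is confronted with: its query, its answer, all the messages, and
the indices of the messages that were cached from it. -/
def view (S : Scheme N K m A L) (θ : Fin K) (H : Prefetch N K m) (n : Fin N) :
    PMF (S.Query n × S.Answer n × Messages K L A × Finset (Fin K)) :=
  (S.joint θ H).map fun z => (z.2 n, S.answer n (z.2 n) z.1, z.1, H.cached n)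

/-- Privacy: to database `n`, all the pairs (desired index, prefetched indices) that agree with
the messages cached from database `n` look the same. -/
def IsPrivate (S : Scheme N K m A L) : Prop :=
  ∀ (n : Fin N) (H H' : Prefetch N K m) (θ θ' : Fin K), H.cached n = H'.cached n →
    θ ∉ H.all → θ' ∉ H'.all → S.view θ H n = S.view θ' H' n

/-- `H(W_θ | W_H, Q_1, …, Q_N, A_1, …, A_N)`, in symbols. -/
def uncertainty (S : Scheme N K m A L) (θ : Fin K) (H : Prefetch N K m) : ℝ≥0∞ :=
  condEntropy (Fintype.card A)
    ((S.joint θ H).map fun z =>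
      (z.1 θ, ((fun i : H.all => z.1 i), z.2, fun n => S.answer n (z.2 n) z.1)))

/-- The download cost `H(A_1) + ⋯ + H(A_N)`, in symbols. -/
def cost (S : Scheme N K m A L) (θ : Fin K) (H : Prefetch N K m) : ℝ≥0∞ :=
  ∑ n, entropy (Fintype.card A) ((S.joint θ H).map fun z => S.answer n (z.2 n) z.1)

end Scheme

/-- The normalized download cost `d` is achievable with the prefetching vector `m`: there are
private schemes of arbitrarily large message length `L` with download cost at most `d * L` and with
a remaining uncertainty about the desired message which is `o(L)`. -/
def Achievable {N : ℕ} (K : ℕ) (m : Fin N → ℕ) (A : Type) [Fintype A] [Nonempty A]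
    (d : ℝ≥0∞) : Prop :=
  ∀ ε : ℝ, 0 < ε → ∀ L₀ : ℕ, ∃ L : ℕ, L₀ ≤ L ∧ ∃ S : Scheme N K m A L, S.IsPrivate ∧
    ∀ (H : Prefetch N K m) (θ : Fin K), θ ∉ H.all →
      S.uncertainty θ H ≤ ENNReal.ofReal (ε * L) ∧ S.cost θ H ≤ d * L

/-- The optimal normalized download cost for the prefetching vector `m`. -/
def optimalCostFor {N : ℕ} (K : ℕ) (m : Fin N → ℕ) (A : Type) [Fintype A] [Nonempty A] : ℝ≥0∞ :=
  sInf {d | Achievable K m A d}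

/-- The optimal normalized download cost `D*` under the cache size constraint `∑ n, m n ≤ M`. -/
def optimalCost (N K M : ℕ) (A : Type) [Fintype A] [Nonempty A] : ℝ≥0∞ :=
  sInf {d | ∃ m : Fin N → ℕ, ∑ n, m n ≤ M ∧ Achievable K m A d}

/-- The capacity: the supremum of the achievable retrieval rates `R` (the reciprocals of the
achievable normalized download costs) under the cache size constraint. -/
def capacity (N K M : ℕ) (A : Type) [Fintype A] [Nonempty A] : ℝ≥0∞ :=
  sSup {R | ∃ m : Fin N → ℕ, ∑ n, m n ≤ M ∧ Achievable K m A R⁻¹}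

end

end SideInfoPIR

namespace SideInfoPIR

/-! ### Shannon inequalities for functions of a uniform variable -/

section UniformEntropy

variable {Ω α β γ : Type} [Fintype Ω]

/-! Converse. Fix the prefetched sets and write h(T) for the entropy of all answers given the
queries and the messages in T, where T contains the cache. The answers reveal `W_θ` up to the
allowed uncertainty, so for θ outside T, h(T) ≥ L + h(T ∪ {θ}) - o(L)
(`length_add_meanAnswersEntropy_le`). By privacy each single answer, given its query and T ∪ {θ},
has the same entropy when another θ' is desired. The joint answer entropy for θ' is at most the sum
of these, and the sum is at most N times the joint entropy for θ. Each newly revealed message thus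
costs a factor 1/N, and induction on the number of messages outside T gives the geometric sum
(`length_mul_geom_le_meanAnswersEntropy`). Only privacy of θ for a fixed cache is used.

Achievability. For N ≥ 2, every pattern v in (ZMod N)^K is used once, in a random order; database n
sees the patterns with coordinate θ shifted by n, and would return sums of one symbol per message,
the symbol of index 0 being zero. Of the N^K sums, the N^M whose pattern vanishes off the cache are
known to the user. A database need not know which ones: it sends N^K - N^M Vandermonde parities
(`achievable_of_symbol_scheme`). The queries ignore the cache altogether. The cost is N(N^K - N^M)
field symbols for N^K(N-1) message symbols, which is the geometric sum.

Since queries and messages are independent, every entropy in the converse is an average over queries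
of entropies of functions of uniform messages, so the Shannon inequalities reduce to counting
fibers. -/

open Classical in
/-- The number of points at which `f` takes the same value as at `ω`. -/
noncomputable def fiberCard (f : Ω → α) (ω : Ω) : ℕ :=
  (Finset.univ.filter fun ω' => f ω' = f ω).card

/-- The entropy, in units of `log b`, of a function of a uniformly distributed variable. -/
noncomputable def unifEntropy (b : ℕ) (f : Ω → α) : ℝ :=
  (∑ ω, Real.logb b (Fintype.card Ω / fiberCard f ω)) / Fintype.card Ω

lemma fiberCard_pos (f : Ω → α) (ω : Ω) : 0 < fiberCard f ω :=
  Finset.card_pos.2 ⟨ω, by simp⟩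

lemma fiberCard_le_card (f : Ω → α) (ω : Ω) : fiberCard f ω ≤ Fintype.card Ω :=
  Finset.card_le_univ _

lemma fiberCard_anti {f : Ω → α} {g : Ω → β} (h : ∀ ω ω', g ω = g ω' → f ω = f ω') (ω : Ω) :
    fiberCard g ω ≤ fiberCard f ω :=
  Finset.card_le_card fun x hx => by
    simp only [Finset.mem_filter, Finset.mem_univ, true_and] at hx ⊢
    exact h _ _ hx

/-- The hypothesis says that g determines f, so the fibers of g lie inside those of f. -/
lemma unifEntropy_mono {b : ℕ} (hb : 1 < b) {f : Ω → α} {g : Ω → β}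
    (h : ∀ ω ω', g ω = g ω' → f ω = f ω') : unifEntropy b f ≤ unifEntropy b g := by
  have hb' : (1 : ℝ) < b := by exact_mod_cast hb
  refine div_le_div_of_nonneg_right (Finset.sum_le_sum fun ω _ => ?_) (by positivity)
  have : 0 < Fintype.card Ω := Fintype.card_pos_iff.2 ⟨ω⟩
  have hf := fiberCard_pos f ω
  have hg := fiberCard_pos g ω
  refine Real.logb_le_logb_of_le hb' (by positivity) ?_
  have := fiberCard_anti h ω
  gcongr

lemma unifEntropy_congr {b : ℕ} (hb : 1 < b) {f : Ω → α} {g : Ω → β}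
    (h : ∀ ω ω', f ω = f ω' ↔ g ω = g ω') : unifEntropy b f = unifEntropy b g :=
  le_antisymm (unifEntropy_mono hb fun _ _ => (h _ _).2) (unifEntropy_mono hb fun _ _ => (h _ _).1)

lemma unifEntropy_const (b : ℕ) : unifEntropy b (fun _ : Ω => ()) = 0 := by
  have : ∀ ω : Ω, fiberCard (fun _ : Ω => ()) ω = Fintype.card Ω := fun ω => by
    simp [fiberCard, Finset.card_univ]
  rw [unifEntropy, Finset.sum_eq_zero, zero_div]
  intro ω _
  have : (Fintype.card Ω : ℝ) ≠ 0 := by exact_mod_cast (Fintype.card_pos_iff.2 ⟨ω⟩).ne'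
  simp_all

/-- The counting core of submodularity. The numerator counts pairs (ω₁, ω₂) agreeing with ω in (f,
k) and (g, k) respectively. After exchanging sums, the points ω compatible with a given pair form
one fiber of (f, g, k) or none, so the pair contributes at most 1 / `fiberCard k ω₁`, and only if k
agrees on it. -/
lemma sum_fiberCard_ratio_le (f : Ω → α) (g : Ω → β) (k : Ω → γ) :
    ∑ ω, (fiberCard (fun ω => (f ω, k ω)) ω * fiberCard (fun ω => (g ω, k ω)) ω : ℝ)
      / (fiberCard (fun ω => (f ω, g ω, k ω)) ω * fiberCard k ω) ≤ Fintype.card Ω := by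
  classical
  have key : ∀ ω₁ ω₂ : Ω, ∑ ω, (if f ω₁ = f ω ∧ k ω₁ = k ω ∧ g ω₂ = g ω ∧ k ω₂ = k ω then
      (1 / (fiberCard (fun ω => (f ω, g ω, k ω)) ω * fiberCard k ω) : ℝ) else 0)
      ≤ if k ω₂ = k ω₁ then (1 / fiberCard k ω₁ : ℝ) else 0 := by
    intro ω₁ ω₂
    by_cases hex : ∃ ω, f ω₁ = f ω ∧ k ω₁ = k ω ∧ g ω₂ = g ω ∧ k ω₂ = k ω
    · obtain ⟨ω₀, h1, h2, h3, h4⟩ := hex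
      rw [if_pos (h4.trans h2.symm)]
      have e1 : fiberCard k ω₁ = fiberCard k ω₀ := by simp [fiberCard, h2]
      have : ∀ ω ∈ (Finset.univ : Finset Ω),
          (if f ω₁ = f ω ∧ k ω₁ = k ω ∧ g ω₂ = g ω ∧ k ω₂ = k ω then
          (1 / (fiberCard (fun ω => (f ω, g ω, k ω)) ω * fiberCard k ω) : ℝ) else 0) =
          if (f ω, g ω, k ω) = (f ω₀, g ω₀, k ω₀) then
          (1 / (fiberCard (fun ω => (f ω, g ω, k ω)) ω₀ * fiberCard k ω₀) : ℝ) else 0 := by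
        intro ω _
        by_cases hω : (f ω, g ω, k ω) = (f ω₀, g ω₀, k ω₀)
        · have hω' := hω
          simp only [Prod.mk.injEq] at hω'
          obtain ⟨a1, a2, a3⟩ := hω'
          rw [if_pos hω, if_pos ⟨h1.trans a1.symm, h2.trans a3.symm, h3.trans a2.symm,
            h4.trans a3.symm⟩]
          simp [fiberCard, a1, a2, a3]
        · rw [if_neg hω, if_neg]
          rintro ⟨b1, b2, b3, b4⟩
          exact hω (by rw [← b1, ← b2, ← b3, h1, h2, h3])
      rw [Finset.sum_congr rfl this, ← Finset.sum_filter, Finset.sum_const, nsmul_eq_mul, e1]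
      have p1 : (0 : ℝ) < fiberCard (fun ω => (f ω, g ω, k ω)) ω₀ := by
        exact_mod_cast fiberCard_pos _ _
      have p2 : (0 : ℝ) < fiberCard k ω₀ := by exact_mod_cast fiberCard_pos _ _
      have e2 : (Finset.univ.filter fun ω => (f ω, g ω, k ω) = (f ω₀, g ω₀, k ω₀)).card =
          fiberCard (fun ω => (f ω, g ω, k ω)) ω₀ := by
        unfold fiberCard
        congr!
      rw [e2]
      apply le_of_eq
      field_simp
    · rw [Finset.sum_eq_zero]
      · split_ifs <;> positivity
      · intro ω _
        exact if_neg fun h => hex ⟨ω, h⟩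
  calc _ = ∑ ω, ∑ ω₁, ∑ ω₂, (if f ω₁ = f ω ∧ k ω₁ = k ω ∧ g ω₂ = g ω ∧ k ω₂ = k ω then
        (1 / (fiberCard (fun ω => (f ω, g ω, k ω)) ω * fiberCard k ω) : ℝ) else 0) := by
        refine Finset.sum_congr rfl fun ω _ => ?_
        rw [← Finset.sum_product', ← Finset.sum_filter, Finset.sum_const, nsmul_eq_mul,
          mul_one_div]
        congr 1
        rw [← Nat.cast_mul]
        congr 1
        simp only [fiberCard]
        rw [← Finset.card_product]
        congr 1
        ext ⟨x, y⟩
        simp [and_assoc]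
    _ = ∑ ω₁, ∑ ω₂, ∑ ω, _ := by
        rw [Finset.sum_comm]
        refine Finset.sum_congr rfl fun ω _ => ?_
        rw [Finset.sum_comm]
    _ ≤ ∑ ω₁, ∑ ω₂, if k ω₂ = k ω₁ then (1 / fiberCard k ω₁ : ℝ) else 0 :=
        Finset.sum_le_sum fun _ _ => Finset.sum_le_sum fun _ _ => key _ _
    _ = ∑ ω₁ : Ω, 1 := by
        refine Finset.sum_congr rfl fun ω _ => ?_
        rw [← Finset.sum_filter, Finset.sum_const, nsmul_eq_mul]
        change (fiberCard k ω : ℝ) * _ = 1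
        have p2 : (0 : ℝ) < fiberCard k ω := by exact_mod_cast fiberCard_pos _ _
        field_simp
    _ = Fintype.card Ω := by simp

/-- Submodularity of the entropy. -/
lemma unifEntropy_submodular {b : ℕ} (hb : 1 < b) (f : Ω → α) (g : Ω → β) (k : Ω → γ) :
    unifEntropy b (fun ω => (f ω, g ω, k ω)) + unifEntropy b k
      ≤ unifEntropy b (fun ω => (f ω, k ω)) + unifEntropy b (fun ω => (g ω, k ω)) := by
  have hb' : (0 : ℝ) < Real.log b := Real.log_pos (by exact_mod_cast hb)
  unfold unifEntropy
  rw [← add_div, ← add_div, ← Finset.sum_add_distrib, ← Finset.sum_add_distrib]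
  refine div_le_div_of_nonneg_right ?_ (by positivity)
  rw [← sub_nonpos, ← Finset.sum_sub_distrib]
  have step : ∀ ω ∈ (Finset.univ : Finset Ω),
      Real.logb b (Fintype.card Ω / fiberCard (fun ω => (f ω, g ω, k ω)) ω)
        + Real.logb b (Fintype.card Ω / fiberCard k ω)
        - (Real.logb b (Fintype.card Ω / fiberCard (fun ω => (f ω, k ω)) ω)
          + Real.logb b (Fintype.card Ω / fiberCard (fun ω => (g ω, k ω)) ω))
      ≤ ((fiberCard (fun ω => (f ω, k ω)) ω * fiberCard (fun ω => (g ω, k ω)) ω : ℝ)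
      / (fiberCard (fun ω => (f ω, g ω, k ω)) ω * fiberCard k ω) - 1) / Real.log b := by
    intro ω _
    have h0 : (0 : ℝ) < Fintype.card Ω := by exact_mod_cast Fintype.card_pos_iff.2 ⟨ω⟩
    have h1 : (0 : ℝ) < fiberCard (fun ω => (f ω, g ω, k ω)) ω := by
      exact_mod_cast fiberCard_pos _ _
    have h2 : (0 : ℝ) < fiberCard k ω := by exact_mod_cast fiberCard_pos _ _
    have h3 : (0 : ℝ) < fiberCard (fun ω => (f ω, k ω)) ω := by exact_mod_cast fiberCard_pos _ _
    have h4 : (0 : ℝ) < fiberCard (fun ω => (g ω, k ω)) ω := by exact_mod_cast fiberCard_pos _ _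
    -- log x ≤ x - 1 at the ratio bounded on average by `sum_fiberCard_ratio_le`.
    have := Real.log_le_sub_one_of_pos (div_pos (mul_pos h3 h4) (mul_pos h1 h2))
    rw [Real.log_div (by positivity) (by positivity), Real.log_mul h3.ne' h4.ne',
      Real.log_mul h1.ne' h2.ne'] at this
    unfold Real.logb
    rw [← add_div, ← add_div, ← sub_div]
    refine div_le_div_of_nonneg_right ?_ hb'.le
    rw [Real.log_div h0.ne' h1.ne', Real.log_div h0.ne' h2.ne', Real.log_div h0.ne' h3.ne',
      Real.log_div h0.ne' h4.ne']
    linarith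
  refine (Finset.sum_le_sum step).trans ?_
  rw [← Finset.sum_div, Finset.sum_sub_distrib]
  have := sum_fiberCard_ratio_le f g k
  refine div_nonpos_of_nonpos_of_nonneg ?_ hb'.le
  simp only [Finset.sum_const, Finset.card_univ, nsmul_eq_mul, mul_one]
  linarith

lemma unifEntropy_pair_le {b : ℕ} (hb : 1 < b) (f : Ω → α) (g : Ω → β) :
    unifEntropy b (fun ω => (f ω, g ω)) ≤ unifEntropy b f + unifEntropy b g := by
  have := unifEntropy_submodular hb f g (fun _ => ())
  rw [unifEntropy_const, add_zero] at this
  rwa [unifEntropy_congr hb (g := fun ω => (f ω, g ω)) (by simp),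
    unifEntropy_congr hb (f := fun ω => (f ω, ())) (g := f) (by simp),
    unifEntropy_congr hb (f := fun ω => (g ω, ())) (g := g) (by simp)] at this

/-- Conditional subadditivity: submodularity adds one variable of the family at a time. -/
lemma unifEntropy_family_le {b : ℕ} (hb : 1 < b) {ι : Type} [Fintype ι] {τ : ι → Type}
    (a : ∀ i, Ω → τ i) (k : Ω → γ) :
    unifEntropy b (fun ω => ((fun i => a i ω), k ω)) - unifEntropy b k
      ≤ ∑ i, (unifEntropy b (fun ω => (a i ω, k ω)) - unifEntropy b k) := by
  classical
  have : ∀ s : Finset ι,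
      unifEntropy b (fun ω => ((fun i : s => a i ω), k ω)) - unifEntropy b k
      ≤ ∑ i ∈ s, (unifEntropy b (fun ω => (a i ω, k ω)) - unifEntropy b k) := by
    intro s
    induction s using Finset.induction_on with
    | empty =>
      rw [Finset.sum_empty, sub_nonpos]
      exact unifEntropy_mono hb fun ω ω' h => by
        refine Prod.ext (funext fun i => ?_) h
        exact absurd i.2 (Finset.notMem_empty _)
    | insert i s hi ih =>
      rw [Finset.sum_insert hi]
      have h1 := unifEntropy_submodular hb (a i) (fun ω => fun j : s => a j ω) k
      have h2 : unifEntropy b (fun ω => ((fun j : (insert i s : Finset ι) => a j ω), k ω)) ≤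
          unifEntropy b (fun ω => (a i ω, (fun j : s => a j ω), k ω)) := by
        refine unifEntropy_mono hb fun ω ω' h => ?_
        simp only [Prod.mk.injEq] at h ⊢
        refine ⟨funext fun j => ?_, h.2.2⟩
        obtain ⟨j, hj⟩ := j
        rcases Finset.mem_insert.1 hj with rfl | hj'
        · exact h.1
        · exact congrFun h.2.1 ⟨j, hj'⟩
      linarith
  refine le_trans (le_of_eq ?_) (this Finset.univ)
  congr 1
  refine unifEntropy_congr hb fun ω ω' => ?_
  simp only [Prod.mk.injEq, funext_iff, Subtype.forall, Finset.mem_univ, forall_const]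

end UniformEntropy

/-! ### Independence of the messages -/

section Messages

variable {K L : ℕ} {A : Type} [Fintype A]

/-- Splitting off the content of message θ is a bijection: with S prescribed, θ is still free. -/
lemma fiberCard_restrict_insert {S : Finset (Fin K)} {θ : Fin K} (hθ : θ ∉ S)
    (w : Messages K L A) :
    fiberCard (fun (w : Messages K L A) (i : S) => w i) w =
      Fintype.card A ^ L *
        fiberCard (fun (w : Messages K L A) (i : (insert θ S : Finset (Fin K))) => w i) w := by
  classical
  have : Fintype.card A ^ L = (Finset.univ : Finset (Fin L → A)).card := by simp
  rw [this, fiberCard, fiberCard, ← Finset.card_product]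
  refine Finset.card_bij' (fun w' _ => (w' θ, Function.update w' θ (w θ)))
    (fun z _ => Function.update z.2 θ z.1) ?_ ?_ ?_ ?_
  · intro w' hw'
    simp only [Finset.mem_filter, Finset.mem_univ, true_and, funext_iff, Subtype.forall,
      Finset.mem_product, Finset.mem_insert] at hw' ⊢
    intro i hi l
    by_cases h : i = θ
    · subst h; simp
    · rw [Function.update_of_ne h]
      exact hw' i (hi.resolve_left h) l
  · intro z hz
    simp only [Finset.mem_filter, Finset.mem_univ, true_and, funext_iff, Subtype.forall,
      Finset.mem_product, Finset.mem_insert] at hz ⊢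
    intro i hi l
    have h : i ≠ θ := by rintro rfl; exact hθ hi
    rw [Function.update_of_ne h]
    exact hz i (Or.inr hi) l
  · intro w' _
    simp
  · intro z hz
    simp only [Finset.mem_filter, Finset.mem_univ, true_and, funext_iff, Subtype.forall,
      Finset.mem_product, Finset.mem_insert] at hz
    have : w θ = z.2 θ := (funext fun l => hz θ (Or.inl rfl) l).symm
    simp [this]

lemma unifEntropy_restrict_insert [Nontrivial A] {S : Finset (Fin K)} {θ : Fin K} (hθ : θ ∉ S) :
    unifEntropy (Fintype.card A)
      (fun (w : Messages K L A) (i : (insert θ S : Finset (Fin K))) => w i) =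
      unifEntropy (Fintype.card A) (fun (w : Messages K L A) (i : S) => w i) + L := by
  have hb : (1 : ℝ) < Fintype.card A := by exact_mod_cast Fintype.one_lt_card
  have h0 : (0 : ℝ) < Fintype.card (Messages K L A) := by exact_mod_cast Fintype.card_pos
  rw [unifEntropy, unifEntropy, div_add' _ _ _ h0.ne']
  congr 1
  have : (L : ℝ) * Fintype.card (Messages K L A) = ∑ _w : Messages K L A, (L : ℝ) := by
    simp [mul_comm]
  rw [this, ← Finset.sum_add_distrib]
  refine Finset.sum_congr rfl fun w _ => ?_
  rw [fiberCard_restrict_insert hθ]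
  have h1 : (0 : ℝ) < fiberCard
      (fun (w : Messages K L A) (i : (insert θ S : Finset (Fin K))) => w i) w := by
    exact_mod_cast fiberCard_pos _ _
  have hb0 : (0 : ℝ) < Fintype.card A := by linarith
  have hL : (L : ℝ) = Real.logb (Fintype.card A) ((Fintype.card A : ℝ) ^ L) := by
    rw [Real.logb_pow, Real.logb_self_eq_one hb, mul_one]
  rw [hL, Nat.cast_mul, Nat.cast_pow,
    ← Real.logb_mul (div_pos h0 (mul_pos (pow_pos hb0 _) h1)).ne' (by positivity)]
  congr 1
  field_simp

end Messages

/-! ### Entropy of discrete laws, and its disintegration over the queries -/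

section DiscreteEntropy

variable {α β γ : Type}

lemma tsum_bind_mul (p : PMF α) (g : α → PMF β) (F : β → ℝ≥0∞) :
    ∑' z, (p.bind g) z * F z = ∑' a, p a * ∑' z, g a z * F z := by
  simp_rw [PMF.bind_apply, ← ENNReal.tsum_mul_right, ← ENNReal.tsum_mul_left]
  rw [ENNReal.tsum_comm]
  simp_rw [mul_assoc]

lemma tsum_pure_mul (a : α) (F : α → ℝ≥0∞) : ∑' z, (PMF.pure a) z * F z = F a := by
  classical
  rw [tsum_eq_single a]
  · simp
  · intro b hb
    simp [PMF.pure_apply, hb]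

lemma tsum_map_mul (p : PMF α) (f : α → β) (F : β → ℝ≥0∞) :
    ∑' z, (p.map f) z * F z = ∑' a, p a * F (f a) := by
  rw [PMF.map, tsum_bind_mul]
  simp_rw [Function.comp, tsum_pure_mul]

open Classical in
lemma map_apply_eq_tsum (p : PMF α) (f : α → β) (y : β) :
    (p.map f) y = ∑' a, p a * if f a = y then 1 else 0 := by
  rw [PMF.map_apply]
  exact tsum_congr fun a => by simp [eq_comm]

/-- The information content, in units of `log b`, of an event of probability `x`. -/
noncomputable def info (b : ℕ) (x : ℝ≥0∞) : ℝ≥0∞ := ENNReal.ofReal (-Real.logb b x.toReal)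

lemma entropy_eq_tsum (b : ℕ) (p : PMF α) : entropy b p = ∑' a, p a * info b (p a) := by
  refine tsum_congr fun a => ?_
  rw [info, neg_mul_eq_mul_neg, ENNReal.ofReal_mul ENNReal.toReal_nonneg,
    ENNReal.ofReal_toReal (p.apply_ne_top a)]

lemma condEntropy_eq_tsum (b : ℕ) (r : PMF (α × β)) :
    condEntropy b r = ∑' z, r z *
      ENNReal.ofReal (Real.logb b (((r.map Prod.snd) z.2).toReal / (r z).toReal)) := by
  refine tsum_congr fun a => ?_
  rw [ENNReal.ofReal_mul ENNReal.toReal_nonneg, ENNReal.ofReal_toReal (r.apply_ne_top a)]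

/-- The tangent line inequality behind the concavity of `x ↦ -x log x`. -/
lemma mul_info_add_le {b : ℕ} (hb : 1 < b) {x y : ℝ≥0∞} (hx : x ≤ 1) (hy : y ≤ 1)
    (hxy : y = 0 → x = 0) :
    x * info b x + x * ENNReal.ofReal (1 / Real.log b)
      ≤ x * info b y + y * ENNReal.ofReal (1 / Real.log b) := by
  have hb' : (0 : ℝ) < Real.log b := Real.log_pos (by exact_mod_cast hb)
  rcases eq_or_ne x 0 with rfl | hx0
  · simp
  have hy0 : y ≠ 0 := fun h => hx0 (hxy h)
  have hxt : x ≠ ∞ := ne_top_of_le_ne_top ENNReal.one_ne_top hx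
  have hyt : y ≠ ∞ := ne_top_of_le_ne_top ENNReal.one_ne_top hy
  obtain ⟨s, rfl⟩ : ∃ s : NNReal, x = s := ⟨x.toNNReal, (ENNReal.coe_toNNReal hxt).symm⟩
  obtain ⟨t, rfl⟩ : ∃ t : NNReal, y = t := ⟨y.toNNReal, (ENNReal.coe_toNNReal hyt).symm⟩
  have hs : 0 < (s : ℝ) := by
    have : s ≠ 0 := by simpa using hx0
    positivity
  have ht : 0 < (t : ℝ) := by
    have : t ≠ 0 := by simpa using hy0
    positivity
  have hs1 : (s : ℝ) ≤ 1 := by exact_mod_cast hx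
  have ht1 : (t : ℝ) ≤ 1 := by exact_mod_cast hy
  have n1 : 0 ≤ -Real.log s := by have := Real.log_nonpos hs.le hs1; linarith
  have n2 : 0 ≤ -Real.log t := by have := Real.log_nonpos ht.le ht1; linarith
  unfold info
  rw [ENNReal.coe_toReal, ENNReal.coe_toReal, ← ENNReal.ofReal_coe_nnreal (p := s),
    ← ENNReal.ofReal_coe_nnreal (p := t)]
  simp only [Real.logb, ← neg_div]
  rw [← ENNReal.ofReal_mul hs.le, ← ENNReal.ofReal_mul hs.le, ← ENNReal.ofReal_mul hs.le,
    ← ENNReal.ofReal_mul ht.le, ← ENNReal.ofReal_add (by positivity) (by positivity),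
    ← ENNReal.ofReal_add (by positivity) (by positivity)]
  refine ENNReal.ofReal_le_ofReal ?_
  have key := Real.log_le_sub_one_of_pos (div_pos ht hs)
  rw [Real.log_div ht.ne' hs.ne'] at key
  have key2 : (s : ℝ) * (Real.log t - Real.log s) ≤ t - s := by
    refine (mul_le_mul_of_nonneg_left key hs.le).trans (le_of_eq ?_)
    field_simp
  rw [← mul_div_assoc, ← mul_div_assoc, ← mul_div_assoc, ← mul_div_assoc, ← add_div, ← add_div]
  refine div_le_div_of_nonneg_right ?_ hb'.le
  linarith

/-- Conditioning does not increase the entropy. -/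
lemma tsum_entropy_le_entropy_bind {b : ℕ} (hb : 1 < b) (p : PMF α) (g : α → PMF β) :
    ∑' q, p q * entropy b (g q) ≤ entropy b (p.bind g) := by
  -- The tangent inequality in `ℝ≥0∞` carries a multiple of the mass on each side. After averaging,
  -- both become the same finite `(p.bind g) y * c`, which cancels.
  set c := ENNReal.ofReal (1 / Real.log b)
  have hpt : ∀ y, ∑' q, p q * (g q y * info b (g q y))
      ≤ (p.bind g) y * info b ((p.bind g) y) := by
    intro y
    have hfin : (p.bind g) y * c ≠ ∞ :=
      ENNReal.mul_ne_top ((p.bind g).apply_ne_top y) ENNReal.ofReal_ne_top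
    refine (ENNReal.add_le_add_iff_right hfin).1 ?_
    have e1 : ∀ F : ℝ≥0∞, (p.bind g) y * F = ∑' q, p q * (g q y * F) := by
      intro F
      rw [PMF.bind_apply, ← ENNReal.tsum_mul_right]
      simp_rw [mul_assoc]
    have e2 : (p.bind g) y * c = ∑' q, p q * ((p.bind g) y * c) := by
      rw [ENNReal.tsum_mul_right, p.tsum_coe, one_mul]
    calc _ = ∑' q, (p q * (g q y * info b (g q y)) + p q * (g q y * c)) := by
          rw [e1 c, ENNReal.tsum_add]
      _ ≤ ∑' q, (p q * (g q y * info b ((p.bind g) y)) + p q * ((p.bind g) y * c)) := by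
          refine ENNReal.tsum_le_tsum fun q => ?_
          rw [← mul_add (p q), ← mul_add (p q)]
          rcases eq_or_ne (p q) 0 with h | h
          · simp [h]
          · refine mul_le_mul_right (mul_info_add_le hb ((g q).coe_le_one y)
              ((p.bind g).coe_le_one y) fun h0 => ?_) _
            rw [PMF.bind_apply, ENNReal.tsum_eq_zero] at h0
            exact (mul_eq_zero.1 (h0 q)).resolve_left h
      _ = _ := by rw [ENNReal.tsum_add, ← e1, ← e2]
  rw [entropy_eq_tsum]
  refine le_trans (le_of_eq ?_) (ENNReal.tsum_le_tsum hpt)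
  rw [ENNReal.tsum_comm]
  simp_rw [ENNReal.tsum_mul_left, entropy_eq_tsum]

/-- Gibbs' inequality against the uniform law: the tangent inequality with y = 1/n, summed. -/
lemma entropy_le_logb_card {b : ℕ} (hb : 1 < b) [Fintype α] [Nonempty α] (p : PMF α) :
    entropy b p ≤ ENNReal.ofReal (Real.logb b (Fintype.card α)) := by
  set c := ENNReal.ofReal (1 / Real.log b)
  set n : ℝ≥0∞ := (Fintype.card α : ℝ≥0∞)
  have hn : n ≠ 0 := by simp [n]
  have hn' : n ≠ ∞ := by simp [n]
  have h1 : (1 : ℝ≥0∞) ≤ n := Nat.one_le_cast.2 Fintype.card_pos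
  refine (ENNReal.add_le_add_iff_right (a := c) ENNReal.ofReal_ne_top).1 ?_
  have hp : ∑ a, p a = 1 := by
    have := p.tsum_coe
    rwa [tsum_fintype] at this
  calc _ = ∑ a, (p a * info b (p a) + p a * c) := by
        rw [Finset.sum_add_distrib, ← Finset.sum_mul, hp, one_mul, entropy_eq_tsum, tsum_fintype]
    _ ≤ ∑ a, (p a * info b n⁻¹ + n⁻¹ * c) :=
        Finset.sum_le_sum fun a _ => mul_info_add_le hb (p.coe_le_one a)
          (ENNReal.inv_le_one.2 h1) fun h => absurd h (ENNReal.inv_ne_zero.2 hn')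
    _ = _ := by
        rw [Finset.sum_add_distrib, ← Finset.sum_mul, hp, one_mul, Finset.sum_const,
          nsmul_eq_mul, ← mul_assoc, Finset.card_univ, ENNReal.mul_inv_cancel hn hn', one_mul]
        simp [info, n, ENNReal.toReal_inv, Real.logb_inv]

/-- On the support v determines u, so each pair has the same probability as its v-part. -/
lemma condEntropy_eq_zero (b : ℕ) (p : PMF α) (u : α → β) (v : α → γ)
    (h : ∀ z z', p z ≠ 0 → p z' ≠ 0 → v z = v z' → u z = u z') :
    condEntropy b (p.map fun z => (u z, v z)) = 0 := by
  classical
  rw [condEntropy_eq_tsum, tsum_map_mul, PMF.map_comp, ENNReal.tsum_eq_zero]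
  intro z
  rcases eq_or_ne (p z) 0 with hz | hz
  · simp [hz]
  have : (p.map (Prod.snd ∘ fun z => (u z, v z))) (v z)
      = (p.map fun z => (u z, v z)) (u z, v z) := by
    rw [map_apply_eq_tsum, map_apply_eq_tsum]
    refine tsum_congr fun z' => ?_
    rcases eq_or_ne (p z') 0 with hz' | hz'
    · simp [hz']
    congr 1
    have := h z' z hz' hz
    simp only [Function.comp, Prod.mk.injEq]
    by_cases h' : v z' = v z
    · simp [h', this h']
    · simp [h']
  dsimp only
  rw [this]
  by_cases h0 : ((p.map fun z => (u z, v z)) (u z, v z)).toReal = 0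
  · rw [h0]; simp
  · rw [div_self h0]; simp

variable {Ω : Type} [Fintype Ω] [Nonempty Ω]

lemma map_uniform_apply (f : Ω → α) (ω : Ω) :
    ((PMF.uniformOfFintype Ω).map f) (f ω) = fiberCard f ω / Fintype.card Ω := by
  classical
  rw [map_apply_eq_tsum, tsum_fintype]
  simp only [PMF.uniformOfFintype_apply, ← Finset.mul_sum]
  rw [Finset.sum_boole, mul_comm, ENNReal.div_eq_inv_mul, mul_comm]
  congr 2

lemma sum_ofReal_logb {b : ℕ} (c : Ω → ℝ) (hc : ∀ ω, 0 ≤ Real.logb b (c ω)) :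
    ∑ ω, (Fintype.card Ω : ℝ≥0∞)⁻¹ * ENNReal.ofReal (Real.logb b (c ω))
      = ENNReal.ofReal ((∑ ω, Real.logb b (c ω)) / Fintype.card Ω) := by
  rw [← Finset.mul_sum, ← ENNReal.ofReal_sum_of_nonneg fun ω _ => hc ω,
    ENNReal.ofReal_div_of_pos (by exact_mod_cast Fintype.card_pos), ENNReal.div_eq_inv_mul,
    ENNReal.ofReal_natCast]

lemma entropy_map_uniform {b : ℕ} (hb : 1 < b) (f : Ω → α) :
    entropy b ((PMF.uniformOfFintype Ω).map f) = ENNReal.ofReal (unifEntropy b f) := by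
  have hb' : (1 : ℝ) < b := by exact_mod_cast hb
  rw [entropy_eq_tsum, tsum_map_mul, tsum_fintype, unifEntropy, ← sum_ofReal_logb]
  · refine Finset.sum_congr rfl fun ω _ => ?_
    rw [map_uniform_apply, PMF.uniformOfFintype_apply, info, ← Real.logb_inv]
    simp
  · intro ω
    refine Real.logb_nonneg hb' ?_
    rw [one_le_div (by exact_mod_cast fiberCard_pos f ω)]
    exact_mod_cast fiberCard_le_card f ω

lemma unifEntropy_pair_sub {b : ℕ} (f : Ω → α) (g : Ω → β) :
    unifEntropy b (fun ω => (f ω, g ω)) - unifEntropy b g =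
      (∑ ω, Real.logb b (fiberCard g ω / fiberCard (fun ω => (f ω, g ω)) ω)) / Fintype.card Ω := by
  rw [unifEntropy, unifEntropy, ← sub_div, ← Finset.sum_sub_distrib]
  congr 1
  refine Finset.sum_congr rfl fun ω _ => ?_
  have h0 : (Fintype.card Ω : ℝ) ≠ 0 := by exact_mod_cast Fintype.card_ne_zero
  have h1 : (fiberCard g ω : ℝ) ≠ 0 := by exact_mod_cast (fiberCard_pos _ _).ne'
  have h2 : (fiberCard (fun ω => (f ω, g ω)) ω : ℝ) ≠ 0 := by
    exact_mod_cast (fiberCard_pos _ _).ne'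
  rw [Real.logb_div h0 h2, Real.logb_div h0 h1, Real.logb_div h1 h2]
  ring

/-- The joint law of an independent pair whose first component is uniform. -/
noncomputable def unifProd (Ω : Type) [Fintype Ω] [Nonempty Ω] (p : PMF β) : PMF (Ω × β) :=
  (PMF.uniformOfFintype Ω).bind fun w => p.map fun q => (w, q)

lemma unifProd_map (p : PMF β) (f : Ω × β → α) :
    (unifProd Ω p).map f
      = p.bind fun q => (PMF.uniformOfFintype Ω).map fun w => f (w, q) := by
  rw [unifProd, PMF.map_bind]
  simp_rw [PMF.map_comp]
  simp_rw [PMF.map]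
  exact PMF.bind_comm _ _ _

lemma unifProd_map_snd (p : PMF β) (f : β → α) :
    (unifProd Ω p).map (fun z => f z.2) = p.map f := by
  rw [unifProd_map]
  have : ∀ q : β, (PMF.uniformOfFintype Ω).map (fun _ => f q) = PMF.pure (f q) :=
    fun q => PMF.map_const _ _
  simp_rw [this]
  rfl

lemma tsum_unifProd_mul (p : PMF β) (F : Ω × β → ℝ≥0∞) :
    ∑' z, unifProd Ω p z * F z =
      ∑' q, p q * ∑ w, (Fintype.card Ω : ℝ≥0∞)⁻¹ * F (w, q) := by
  rw [unifProd, tsum_bind_mul]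
  simp_rw [tsum_map_mul, ← ENNReal.tsum_mul_left]
  rw [ENNReal.tsum_comm]
  refine tsum_congr fun q => ?_
  rw [tsum_fintype, Finset.mul_sum]
  refine Finset.sum_congr rfl fun w _ => ?_
  rw [PMF.uniformOfFintype_apply]
  ring

lemma unifProd_map_apply (p : PMF β) (f : Ω × β → α)
    (hf : ∀ z z', f z = f z' → z.2 = z'.2) (w : Ω) (q : β) :
    ((unifProd Ω p).map f) (f (w, q))
      = p q * (fiberCard (fun w => f (w, q)) w / Fintype.card Ω) := by
  classical
  rw [unifProd_map, PMF.bind_apply, tsum_eq_single q]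
  · rw [← map_uniform_apply]
  · intro q' hq'
    rw [mul_eq_zero]
    right
    rw [map_apply_eq_tsum, ENNReal.tsum_eq_zero]
    intro w'
    rw [if_neg, mul_zero]
    exact fun h => hq' (hf _ _ h)

lemma entropy_unifProd_map_ge {b : ℕ} (hb : 1 < b) (p : PMF β) (f : Ω × β → α) :
    ∑' q, p q * ENNReal.ofReal (unifEntropy b fun w => f (w, q))
      ≤ entropy b ((unifProd Ω p).map f) := by
  rw [unifProd_map]
  simp_rw [← entropy_map_uniform hb]
  exact tsum_entropy_le_entropy_bind hb _ _

/-- Because v reveals q, the factor `p q` cancels in the ratio of probabilities, leaving a ratio of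
fiber sizes at fixed q. -/
lemma condEntropy_unifProd_map {b : ℕ} (hb : 1 < b) (p : PMF β) (u : Ω × β → α)
    (v : Ω × β → γ) (hv : ∀ z z', v z = v z' → z.2 = z'.2) :
    condEntropy b ((unifProd Ω p).map fun z => (u z, v z)) =
      ∑' q, p q * ENNReal.ofReal (unifEntropy b (fun w => (u (w, q), v (w, q)))
        - unifEntropy b fun w => v (w, q)) := by
  have hb' : (1 : ℝ) < b := by exact_mod_cast hb
  rw [condEntropy_eq_tsum, tsum_map_mul, tsum_unifProd_mul, PMF.map_comp]
  refine tsum_congr fun q => ?_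
  rcases eq_or_ne (p q) 0 with h | h
  · simp [h]
  congr 1
  rw [unifEntropy_pair_sub, ← sum_ofReal_logb]
  · refine Finset.sum_congr rfl fun w _ => ?_
    rw [unifProd_map_apply p (fun z => (u z, v z)) (fun z z' h => hv _ _ (Prod.ext_iff.1 h).2)]
    have e := unifProd_map_apply p v hv w q
    have e' : (Prod.snd ∘ fun z => (u z, v z)) = v := rfl
    dsimp only
    rw [e', e]
    congr 3
    have h1 : (p q).toReal ≠ 0 := (ENNReal.toReal_pos h (p.apply_ne_top q)).ne'
    have h0 : (Fintype.card Ω : ℝ) ≠ 0 := by exact_mod_cast Fintype.card_ne_zero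
    simp only [ENNReal.toReal_mul, ENNReal.toReal_div, ENNReal.toReal_natCast]
    have h2 : (fiberCard (fun w => (u (w, q), v (w, q))) w : ℝ) ≠ 0 := by
      exact_mod_cast (fiberCard_pos _ _).ne'
    field_simp
  · intro w
    refine Real.logb_nonneg hb' ?_
    rw [one_le_div (by exact_mod_cast fiberCard_pos _ w)]
    exact_mod_cast fiberCard_anti (fun _ _ h => (Prod.ext_iff.1 h).2) w

end DiscreteEntropy

namespace Scheme

/-! ### Converse: lower bound on the download -/

section Converse

variable {N K : ℕ} {m : Fin N → ℕ} {A : Type} [Fintype A] [Nontrivial A] {L : ℕ}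

/-- The entropy of the answer of database `n` to the query `q`, given the messages in `T`. -/
noncomputable def answerEntropy (S : Scheme N K m A L) (T : Finset (Fin K)) (n : Fin N)
    (q : S.Query n) : ℝ :=
  unifEntropy (Fintype.card A) (fun w : Messages K L A => (S.answer n q w, fun i : T => w i))
    - unifEntropy (Fintype.card A) fun (w : Messages K L A) (i : T) => w i

/-- The entropy of all the answers to the queries `Q`, given the messages in `T`. -/
noncomputable def answersEntropy (S : Scheme N K m A L) (T : Finset (Fin K))
    (Q : ∀ n, S.Query n) : ℝ :=
  unifEntropy (Fintype.card A)
    (fun w : Messages K L A => ((fun n => S.answer n (Q n) w), fun i : T => w i))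
    - unifEntropy (Fintype.card A) fun (w : Messages K L A) (i : T) => w i

/-- The entropy of all the answers, given the queries and the messages in `T`. -/
noncomputable def meanAnswersEntropy (S : Scheme N K m A L) (θ : Fin K) (H : Prefetch N K m)
    (T : Finset (Fin K)) : ℝ≥0∞ :=
  ∑' Q, S.queryLaw θ H Q * ENNReal.ofReal (S.answersEntropy T Q)

/-- The entropy of the answer of database `n`, given its query and the messages in `T`. -/
noncomputable def meanAnswerEntropy (S : Scheme N K m A L) (θ : Fin K) (H : Prefetch N K m)
    (T : Finset (Fin K)) (n : Fin N) : ℝ≥0∞ :=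
  ∑' Q, S.queryLaw θ H Q * ENNReal.ofReal (S.answerEntropy T n (Q n))

variable (S : Scheme N K m A L)

lemma IsPrivate.map_queryLaw_eq {S : Scheme N K m A L} (hS : S.IsPrivate)
    {H H' : Prefetch N K m} {θ θ' : Fin K} (n : Fin N) (hH : H.cached n = H'.cached n)
    (hθ : θ ∉ H.all) (hθ' : θ' ∉ H'.all) :
    (S.queryLaw θ H).map (fun Q => Q n) = (S.queryLaw θ' H').map fun Q => Q n := by
  have := congrArg (PMF.map Prod.fst) (hS n H H' θ θ' hH hθ hθ')
  unfold view at this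
  rw [PMF.map_comp, PMF.map_comp] at this
  exact (unifProd_map_snd (Ω := Messages K L A) (S.queryLaw θ H) fun Q => Q n).symm.trans
    (this.trans (unifProd_map_snd (Ω := Messages K L A) (S.queryLaw θ' H') fun Q => Q n))

/-- The quantity depends only on the marginal law of query n, which privacy makes independent of θ.
-/
lemma meanAnswerEntropy_eq {S : Scheme N K m A L} (hS : S.IsPrivate) (H : Prefetch N K m)
    {θ θ' : Fin K} (hθ : θ ∉ H.all) (hθ' : θ' ∉ H.all) (T : Finset (Fin K)) (n : Fin N) :
    S.meanAnswerEntropy θ H T n = S.meanAnswerEntropy θ' H T n := by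
  unfold meanAnswerEntropy
  rw [← tsum_map_mul (S.queryLaw θ H) (fun Q => Q n)
      (fun q => ENNReal.ofReal (S.answerEntropy T n q)),
    ← tsum_map_mul (S.queryLaw θ' H) (fun Q => Q n)
      (fun q => ENNReal.ofReal (S.answerEntropy T n q)), hS.map_queryLaw_eq n rfl hθ hθ']

lemma answerEntropy_nonneg (T : Finset (Fin K)) (n : Fin N) (q : S.Query n) :
    0 ≤ S.answerEntropy T n q :=
  sub_nonneg.2 <| unifEntropy_mono Fintype.one_lt_card fun _ _ h => (Prod.ext_iff.1 h).2

lemma answersEntropy_nonneg (T : Finset (Fin K)) (Q : ∀ n, S.Query n) :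
    0 ≤ S.answersEntropy T Q :=
  sub_nonneg.2 <| unifEntropy_mono Fintype.one_lt_card fun _ _ h => (Prod.ext_iff.1 h).2

lemma answerEntropy_le_answersEntropy (T : Finset (Fin K)) (n : Fin N) (Q : ∀ n, S.Query n) :
    S.answerEntropy T n (Q n) ≤ S.answersEntropy T Q := by
  refine sub_le_sub_right (unifEntropy_mono Fintype.one_lt_card fun w w' h => ?_) _
  simp only [Prod.mk.injEq] at h ⊢
  exact ⟨congrFun h.1 n, h.2⟩

lemma answersEntropy_le_sum (T : Finset (Fin K)) (Q : ∀ n, S.Query n) :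
    S.answersEntropy T Q ≤ ∑ n, S.answerEntropy T n (Q n) :=
  unifEntropy_family_le Fintype.one_lt_card (fun n w => S.answer n (Q n) w) _

lemma meanAnswersEntropy_le_sum (θ : Fin K) (H : Prefetch N K m) (T : Finset (Fin K)) :
    S.meanAnswersEntropy θ H T ≤ ∑ n, S.meanAnswerEntropy θ H T n := by
  unfold meanAnswersEntropy meanAnswerEntropy
  rw [← Summable.tsum_finsetSum fun _ _ => ENNReal.summable]
  refine ENNReal.tsum_le_tsum fun Q => ?_
  rw [← Finset.mul_sum, ← ENNReal.ofReal_sum_of_nonneg fun n _ => S.answerEntropy_nonneg T n _]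
  gcongr
  exact S.answersEntropy_le_sum T Q

lemma sum_le_meanAnswersEntropy (θ : Fin K) (H : Prefetch N K m) (T : Finset (Fin K)) :
    ∑ n, S.meanAnswerEntropy θ H T n ≤ N * S.meanAnswersEntropy θ H T := by
  calc _ ≤ ∑ _n : Fin N, S.meanAnswersEntropy θ H T := by
        refine Finset.sum_le_sum fun n _ => ENNReal.tsum_le_tsum fun Q => ?_
        gcongr
        exact S.answerEntropy_le_answersEntropy T n Q
    _ = _ := by simp

/-- Conditioning on T and then on the queries can only lower the entropy of an answer. -/
lemma sum_meanAnswerEntropy_le_cost (θ : Fin K) (H : Prefetch N K m) (T : Finset (Fin K)) :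
    ∑ n, S.meanAnswerEntropy θ H T n ≤ S.cost θ H := by
  refine Finset.sum_le_sum fun n _ => ?_
  refine le_trans (ENNReal.tsum_le_tsum fun Q => ?_)
    (entropy_unifProd_map_ge Fintype.one_lt_card (S.queryLaw θ H) fun z => S.answer n (z.2 n) z.1)
  gcongr
  rw [answerEntropy, sub_le_iff_le_add]
  exact unifEntropy_pair_le Fintype.one_lt_card _ _

/-- Chain rule for (`W_θ`, answers) given T. Decoding is granted from the cache T₀ only;
submodularity carries its uncertainty over to the larger T. The constant Q in the tuples matches the
form produced by `condEntropy_unifProd_map`. -/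
lemma length_add_answersEntropy_le {T T₀ : Finset (Fin K)} {θ : Fin K} (hT : T₀ ⊆ T)
    (hθ : θ ∉ T) (Q : ∀ n, S.Query n) :
    L + S.answersEntropy (insert θ T) Q ≤ S.answersEntropy T Q
      + (unifEntropy (Fintype.card A) (fun w : Messages K L A =>
          (w θ, (fun i : T₀ => w i), Q, fun n => S.answer n (Q n) w))
        - unifEntropy (Fintype.card A) fun w : Messages K L A =>
          ((fun i : T₀ => w i), Q, fun n => S.answer n (Q n) w)) := by
  have hb : 1 < Fintype.card A := Fintype.one_lt_card
  have h1 := unifEntropy_restrict_insert (L := L) (A := A) hθ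
  have h2 := unifEntropy_submodular hb (fun w : Messages K L A => w θ)
    (fun (w : Messages K L A) (i : T) => w i)
    (fun w : Messages K L A => ((fun i : T₀ => w i), Q, fun n => S.answer n (Q n) w))
  have h3 : unifEntropy (Fintype.card A) (fun w : Messages K L A =>
        ((fun i : T => w i), (fun i : T₀ => w i), Q, fun n => S.answer n (Q n) w))
      ≤ unifEntropy (Fintype.card A)
        (fun w : Messages K L A => ((fun n => S.answer n (Q n) w), fun i : T => w i)) := by
    refine unifEntropy_mono hb fun w w' h => ?_
    simp only [Prod.mk.injEq, true_and] at h ⊢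
    exact ⟨h.2, funext fun i => congrFun h.2 ⟨i.1, hT i.2⟩, h.1⟩
  have h4 : unifEntropy (Fintype.card A) (fun w : Messages K L A =>
        ((fun n => S.answer n (Q n) w), fun i : (insert θ T : Finset (Fin K)) => w i))
      ≤ unifEntropy (Fintype.card A) (fun w : Messages K L A =>
        (w θ, (fun i : T => w i), (fun i : T₀ => w i), Q, fun n => S.answer n (Q n) w)) := by
    refine unifEntropy_mono hb fun w w' h => ?_
    simp only [Prod.mk.injEq, true_and] at h ⊢
    refine ⟨h.2.2.2, funext fun i => ?_⟩
    obtain ⟨i, hi⟩ := i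
    rcases Finset.mem_insert.1 hi with rfl | hi
    · exact h.1
    · exact congrFun h.2.1 ⟨i, hi⟩
  unfold answersEntropy
  linarith

lemma length_add_meanAnswersEntropy_le {H : Prefetch N K m} {T : Finset (Fin K)} {θ : Fin K}
    (hT : H.all ⊆ T) (hθ : θ ∉ T) :
    L + S.meanAnswersEntropy θ H (insert θ T) ≤ S.meanAnswersEntropy θ H T + S.uncertainty θ H := by
  have hb : 1 < Fintype.card A := Fintype.one_lt_card
  -- `S.joint θ H` is `unifProd` by definition.
  have e1 : S.uncertainty θ H = _ := condEntropy_unifProd_map hb (S.queryLaw θ H)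
    (fun z : Messages K L A × (∀ n, S.Query n) => z.1 θ)
    (fun z => ((fun i : H.all => z.1 i), z.2, fun n => S.answer n (z.2 n) z.1))
    (fun z z' h => (Prod.ext_iff.1 (Prod.ext_iff.1 h).2).1)
  have e2 : (L : ℝ≥0∞) = ∑' Q, S.queryLaw θ H Q * L := by
    rw [ENNReal.tsum_mul_right, PMF.tsum_coe, one_mul]
  rw [e1, meanAnswersEntropy, meanAnswersEntropy, e2, ← ENNReal.tsum_add, ← ENNReal.tsum_add]
  refine ENNReal.tsum_le_tsum fun Q => ?_
  rw [← mul_add, ← mul_add]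
  refine mul_le_mul_right ?_ _
  rw [← ENNReal.ofReal_natCast, ← ENNReal.ofReal_add (by positivity) (S.answersEntropy_nonneg _ _),
    ← ENNReal.ofReal_add (S.answersEntropy_nonneg _ _)]
  · exact ENNReal.ofReal_le_ofReal (S.length_add_answersEntropy_le hT hθ Q)
  · exact sub_nonneg.2 <| unifEntropy_mono hb fun _ _ h => (Prod.ext_iff.1 h).2

lemma length_mul_geom_le_meanAnswersEntropy {S : Scheme N K m A L} (hN : 0 < N)
    (hS : S.IsPrivate) {H : Prefetch N K m} {e : ℝ≥0∞}
    (he : ∀ θ ∉ H.all, S.uncertainty θ H ≤ e) (j : ℕ) :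
    ∀ T : Finset (Fin K), H.all ⊆ T → T.card + j = K → ∀ θ, (j ≠ 0 → θ ∉ T) →
      L * ∑ i ∈ Finset.range j, (N : ℝ≥0∞)⁻¹ ^ i ≤ S.meanAnswersEntropy θ H T + j * e := by
  induction j with
  | zero => simp
  | succ j ih =>
    intro T hT hc θ hθ
    have hθ : θ ∉ T := hθ (by simp)
    have hθH : θ ∉ H.all := fun h => hθ (hT h)
    have hc' : (insert θ T).card + j = K := by
      rw [Finset.card_insert_of_notMem hθ]; omega
    -- When j = 0 no message is left to desire; the induction hypothesis is then trivial and θ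
    -- serves again.
    obtain ⟨θ', hθ', hθ'H⟩ : ∃ θ', (j ≠ 0 → θ' ∉ insert θ T) ∧ θ' ∉ H.all := by
      rcases Nat.eq_zero_or_pos j with hj | hj
      · exact ⟨θ, fun h => absurd hj h, hθH⟩
      · have : ∃ θ', θ' ∉ insert θ T := by
          by_contra hcon
          push Not at hcon
          have : insert θ T = Finset.univ := Finset.eq_univ_of_forall hcon
          rw [this, Finset.card_univ, Fintype.card_fin] at hc'
          omega
        obtain ⟨θ', h⟩ := this
        exact ⟨θ', fun _ => h, fun h' => h (Finset.mem_insert_of_mem (hT h'))⟩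
    have h1 := ih (insert θ T) (hT.trans (Finset.subset_insert _ _)) hc' θ' hθ'
    have h2 : S.meanAnswersEntropy θ' H (insert θ T)
        ≤ N * S.meanAnswersEntropy θ H (insert θ T) :=
      (S.meanAnswersEntropy_le_sum θ' H _).trans <| by
        simp_rw [meanAnswerEntropy_eq hS H hθ'H hθH]
        exact S.sum_le_meanAnswersEntropy θ H _
    have h3 := S.length_add_meanAnswersEntropy_le hT hθ
    have hN0 : (N : ℝ≥0∞) ≠ 0 := by exact_mod_cast hN.ne'
    have hNt : (N : ℝ≥0∞) ≠ ∞ := ENNReal.natCast_ne_top N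
    have h4 : (N : ℝ≥0∞)⁻¹ * (L * ∑ i ∈ Finset.range j, (N : ℝ≥0∞)⁻¹ ^ i)
        ≤ S.meanAnswersEntropy θ H (insert θ T) + j * e := by
      calc _ ≤ (N : ℝ≥0∞)⁻¹ * (N * S.meanAnswersEntropy θ H (insert θ T) + N * (j * e)) := by
            gcongr
            refine h1.trans (add_le_add h2 ?_)
            -- The error term is enlarged by N so that N⁻¹ cancels throughout.
            refine le_mul_of_one_le_left' ?_
            exact Nat.one_le_cast.2 hN
        _ = _ := by
            rw [← mul_add, ← mul_assoc, ENNReal.inv_mul_cancel hN0 hNt, one_mul]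
    rw [Finset.sum_range_succ']
    calc _ = L + (N : ℝ≥0∞)⁻¹ * (L * ∑ i ∈ Finset.range j, (N : ℝ≥0∞)⁻¹ ^ i) := by
          simp_rw [pow_succ', ← Finset.mul_sum, pow_zero]
          ring
      _ ≤ L + (S.meanAnswersEntropy θ H (insert θ T) + j * e) := by gcongr
      _ = (L + S.meanAnswersEntropy θ H (insert θ T)) + j * e := by ring
      _ ≤ (S.meanAnswersEntropy θ H T + e) + j * e := by
          refine add_le_add_left (h3.trans ?_) _
          gcongr
          exact he θ hθH
      _ = _ := by push_cast; ring

end Converse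

end Scheme

lemma Prefetch.card_all {N K : ℕ} {m : Fin N → ℕ} (H : Prefetch N K m) :
    H.all.card = ∑ n, m n := by
  rw [Prefetch.all, Finset.card_biUnion fun _ _ _ _ h => H.pairwise_disjoint _ _ h]
  exact Finset.sum_congr rfl fun n _ => H.card_cached n

lemma Prefetch.nonempty {N K : ℕ} {m : Fin N → ℕ} (hm : ∑ n, m n ≤ K) :
    Nonempty (Prefetch N K m) := by
  classical
  have e : (Σ n, Fin (m n)) ↪ Fin K :=
    (Function.Embedding.nonempty_of_card_le (by simpa using hm)).some
  refine ⟨⟨fun n => Finset.univ.map ⟨fun i => e ⟨n, i⟩, fun i j h => by simpa using h⟩, by simp,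
    fun n₁ n₂ h => ?_⟩⟩
  rw [Finset.disjoint_left]
  intro x hx hx'
  simp only [Finset.mem_map, Finset.mem_univ, true_and] at hx hx'
  obtain ⟨i, rfl⟩ := hx
  obtain ⟨j, hj⟩ := hx'
  have := e.injective hj
  simp only [Sigma.mk.injEq] at this
  exact h this.1.symm

/-- The converse: no scheme downloads less than the geometric sum. -/
lemma geom_sum_le_of_achievable {N K : ℕ} (hN : 0 < N) {A : Type} [Fintype A] [Nontrivial A]
    {m : Fin N → ℕ} (hm : ∑ n, m n < K) {d : ℝ≥0∞} (hd : Achievable K m A d) :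
    ∑ i ∈ Finset.range (K - ∑ n, m n), (N : ℝ≥0∞)⁻¹ ^ i ≤ d := by
  obtain ⟨H⟩ := Prefetch.nonempty hm.le
  have hcard := H.card_all
  obtain ⟨θ, hθ⟩ : ∃ θ, θ ∉ H.all := by
    by_contra hcon
    push Not at hcon
    rw [Finset.eq_univ_of_forall hcon, Finset.card_univ, Fintype.card_fin] at hcard
    omega
  have key : ∀ ε : ℝ, 0 < ε → ∑ i ∈ Finset.range (K - ∑ n, m n), (N : ℝ≥0∞)⁻¹ ^ i
      ≤ d + (K - ∑ n, m n : ℕ) * ENNReal.ofReal ε := by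
    intro ε hε
    -- The threshold 1 makes L nonzero, so that L can be cancelled.
    obtain ⟨L, hL, S, hS, hSH⟩ := hd ε hε 1
    have h := Scheme.length_mul_geom_le_meanAnswersEntropy hN hS (H := H)
      (fun θ hθ => (hSH H θ hθ).1) (K - ∑ n, m n) H.all subset_rfl (by omega) θ fun _ => hθ
    have h' := (S.meanAnswersEntropy_le_sum θ H H.all).trans
      ((S.sum_meanAnswerEntropy_le_cost θ H H.all).trans (hSH H θ hθ).2)
    have hL0 : (L : ℝ≥0∞) ≠ 0 := by
      have : L ≠ 0 := by omega
      exact_mod_cast this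
    refine (ENNReal.mul_le_mul_iff_right hL0 (ENNReal.natCast_ne_top L)).1 (h.trans ?_)
    rw [ENNReal.ofReal_mul hε.le, ENNReal.ofReal_natCast]
    calc _ ≤ d * L + (K - ∑ n, m n : ℕ) * (ENNReal.ofReal ε * L) := by gcongr
      _ = _ := by ring
  set j := K - ∑ n, m n
  refine ENNReal.le_of_forall_pos_le_add fun δ hδ _ => ?_
  have hj : (0 : ℝ) < j := by
    have : 0 < j := by omega
    exact_mod_cast this
  refine (key (δ / j) (by positivity)).trans (le_of_eq ?_)
  rw [← ENNReal.ofReal_natCast, ← ENNReal.ofReal_mul hj.le, mul_div_cancel₀ _ hj.ne',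
    ENNReal.ofReal_coe_nnreal]

/-! ### Achievability: permuted patterns and coded download -/

section Achievability

/-- A vector with at most `T` nonzero entries is determined by its first `T` power moments. -/
lemma eq_zero_of_power_sums {F V : Type} [Field F] [Fintype V] {e : V → F}
    (he : Function.Injective e) {T : ℕ} {U : Finset V} (hU : U.card ≤ T) {δ : V → F}
    (hδ : ∀ v ∉ U, δ v = 0) (h : ∀ t : Fin T, ∑ v, δ v * e v ^ (t : ℕ) = 0) (v : V) :
    δ v = 0 := by
  classical
  by_contra hv
  have hvU : v ∈ U := by
    by_contra hvU
    exact hv (hδ v hvU)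
  -- P vanishes at every node of U except that of v, so pairing δ with P isolates `δ v`; its degree
  -- is below T, so the vanishing moments make that pairing zero.
  let P : Polynomial F := ∏ u ∈ U.erase v, (Polynomial.X - Polynomial.C (e u))
  have hdeg : P.natDegree < T := by
    rw [Polynomial.natDegree_finsetProd_X_sub_C_eq_card, Finset.card_erase_of_mem hvU]
    have := Finset.card_pos.2 ⟨v, hvU⟩
    omega
  have h0 : ∑ u, δ u * P.eval (e u) = 0 := by
    simp_rw [Polynomial.eval_eq_sum_range' hdeg, Finset.mul_sum]
    rw [Finset.sum_comm]
    refine Finset.sum_eq_zero fun t ht => ?_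
    have := h ⟨t, Finset.mem_range.1 ht⟩
    calc _ = P.coeff t * ∑ u, δ u * e u ^ t := by
          rw [Finset.mul_sum]
          exact Finset.sum_congr rfl fun u _ => by ring
      _ = 0 := by rw [this, mul_zero]
  rw [Finset.sum_eq_single v] at h0
  · rcases mul_eq_zero.1 h0 with h1 | h1
    · exact hv h1
    · rw [Polynomial.eval_prod, Finset.prod_eq_zero_iff] at h1
      obtain ⟨u, hu, hu'⟩ := h1
      rw [Polynomial.eval_sub, Polynomial.eval_X, Polynomial.eval_C, sub_eq_zero] at hu'
      exact (Finset.mem_erase.1 hu).1 (he hu').symm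
  · intro u _ huv
    by_cases hu : u ∈ U
    · rw [Polynomial.eval_prod, Finset.prod_eq_zero (Finset.mem_erase.2 ⟨huv, hu⟩) (by simp),
        mul_zero]
    · rw [hδ u hu, zero_mul]
  · simp

/-- Fits messages over an arbitrary alphabet into ℓ symbols of a prime field. With L the integer
part of log_b(p^ℓ), less than one alphabet symbol is wasted, however large p is. -/
lemma exists_prime_length {b : ℕ} (hb : 1 < b) {ℓ : ℕ} (hℓ : 0 < ℓ) (n L₁ : ℕ) :
    ∃ p L : ℕ, p.Prime ∧ n ≤ p ∧ L₁ ≤ L ∧ b ^ L ≤ p ^ ℓ ∧ ℓ * Real.logb b p ≤ L + 1 := by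
  have hb' : (1 : ℝ) < b := by exact_mod_cast hb
  obtain ⟨p, hp, hpp⟩ := Nat.exists_infinite_primes (max n (b ^ L₁))
  have hp1 := hpp.one_lt
  refine ⟨p, Nat.log b (p ^ ℓ), hpp, (le_max_left _ _).trans hp, ?_,
    Nat.pow_log_le_self b (pow_pos hpp.pos _).ne', ?_⟩
  · refine Nat.le_log_of_pow_le hb (((le_max_right _ _).trans hp).trans ?_)
    exact Nat.le_self_pow hℓ.ne' p
  · have h := Nat.lt_pow_succ_log_self hb (p ^ ℓ)
    have h' : (p : ℝ) ^ ℓ ≤ (b : ℝ) ^ (Nat.log b (p ^ ℓ) + 1) := by exact_mod_cast h.le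
    have hp0 : (0 : ℝ) < (p : ℝ) ^ ℓ := by
      have := hpp.pos
      positivity
    have := Real.logb_le_logb_of_le hb' hp0 h'
    rw [Real.logb_pow, Real.logb_pow, Real.logb_self_eq_one hb', mul_one] at this
    exact_mod_cast this

/-- Coded download: from databases that would answer with `V`-indexed vectors of field elements of
which all but `T` entries are determined by the side information, it is enough to
download `T` parities per database. -/
lemma achievable_of_symbol_scheme {N K : ℕ} {m : Fin N → ℕ} {A : Type} [Fintype A] [Nontrivial A]
    {Query : Fin N → Type} (law : Fin K → Prefetch N K m → PMF (∀ n, Query n))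
    {ι V : Type} [Fintype ι] [Nonempty ι] [Fintype V]
    (item : ∀ (p : ℕ) (n : Fin N), Query n → (Fin K → ι → ZMod p) → V → ZMod p) (T : ℕ)
    (hlaw : ∀ (H H' : Prefetch N K m) (θ θ' : Fin K) (n : Fin N), θ ∉ H.all → θ' ∉ H'.all →
      (law θ H).map (fun Q => Q n) = (law θ' H').map fun Q => Q n)
    (hknown : ∀ (p : ℕ) (H : Prefetch N K m) (θ : Fin K) (Q : ∀ n, Query n), θ ∉ H.all →
      law θ H Q ≠ 0 → ∀ n, ∃ U : Finset V, U.card ≤ T ∧ ∀ v ∉ U, ∀ x x' : Fin K → ι → ZMod p,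
        (∀ i ∈ H.all, x i = x' i) → item p n (Q n) x v = item p n (Q n) x' v)
    (hdecode : ∀ (p : ℕ) (H : Prefetch N K m) (θ : Fin K) (Q : ∀ n, Query n), θ ∉ H.all →
      law θ H Q ≠ 0 → ∀ x x' : Fin K → ι → ZMod p,
        (∀ n v, item p n (Q n) x v = item p n (Q n) x' v) → x θ = x' θ)
    {d : ℝ} (hd : (N * T : ℝ) / Fintype.card ι < d) : Achievable K m A (ENNReal.ofReal d) := by
  classical
  intro ε hε L₀
  have hb : 1 < Fintype.card A := Fintype.one_lt_card
  set r : ℝ := (N * T : ℝ) / Fintype.card ι with hr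
  have hr0 : 0 ≤ r := by positivity
  have hℓ : 0 < Fintype.card ι := Fintype.card_pos
  obtain ⟨p, L, hp, hpV, hL, hcard, hlog⟩ := exists_prime_length hb hℓ (Fintype.card V)
    -- From this length on, r(L + 1) ≤ dL: the slack d - r pays for the rounding of L.
    (max L₀ ⌈r / (d - r)⌉₊)
  have : Fact p.Prime := ⟨hp⟩
  have hc : Nonempty ((Fin L → A) ↪ (ι → ZMod p)) := by
    refine Function.Embedding.nonempty_of_card_le ?_
    simpa [ZMod.card] using hcard
  have he : Nonempty (V ↪ ZMod p) := by
    refine Function.Embedding.nonempty_of_card_le ?_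
    simpa [ZMod.card] using hpV
  obtain ⟨c⟩ := hc
  obtain ⟨e⟩ := he
  let S : Scheme N K m A L :=
    { Query := Query
      Answer := fun _ => Fin T → ZMod p
      queryLaw := law
      answer := fun n q w t => ∑ v, item p n q (fun k => c (w k)) v * e v ^ (t : ℕ) }
  refine ⟨L, (le_max_left _ _).trans hL, S, ?_, ?_⟩
  · intro n H H' θ θ' hH hθ hθ'
    -- The view of database n is the image of its query marginal under a map that does not involve
    -- θ.
    have h := congrArg (fun μ => (PMF.uniformOfFintype (Messages K L A)).bind fun w =>
      μ.map fun q => (q, S.answer n q w, w, H.cached n)) (hlaw H H' θ θ' n hθ hθ')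
    simp only [PMF.map_comp] at h
    simp only [Scheme.view, Scheme.joint, PMF.map_bind, PMF.map_comp]
    rw [← hH]
    exact h
  · intro H θ hθ
    constructor
    · refine le_trans (le_of_eq ?_) (zero_le)
      refine condEntropy_eq_zero _ (S.joint θ H) (fun z => z.1 θ)
        (fun z => ((fun i : H.all => z.1 i), z.2, fun n => S.answer n (z.2 n) z.1)) ?_
      rintro ⟨w, Q⟩ ⟨w', Q'⟩ hz - hzz
      simp only [Prod.mk.injEq] at hzz
      obtain ⟨hside, rfl, hans⟩ := hzz
      have hQ : law θ H Q ≠ 0 := by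
        intro h0
        refine hz ?_
        change unifProd (Messages K L A) (law θ H) (w, Q) = 0
        rw [unifProd, PMF.bind_apply, ENNReal.tsum_eq_zero]
        intro w₁
        rw [PMF.map_apply, mul_eq_zero]
        right
        rw [ENNReal.tsum_eq_zero]
        intro Q₁
        split_ifs with h1
        · obtain rfl : Q = Q₁ := (Prod.ext_iff.1 h1).2
          exact h0
        · rfl
      refine c.injective (hdecode p H θ Q hθ hQ (fun k => c (w k)) (fun k => c (w' k)) ?_)
      intro n v
      obtain ⟨U, hU, hUeq⟩ := hknown p H θ Q hθ hQ n
      -- Two message tuples with equal side information have item vectors differing only on U; equal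
      -- parities then force equal items.
      refine sub_eq_zero.1 (eq_zero_of_power_sums e.injective hU (δ := fun v =>
        item p n (Q n) (fun k => c (w k)) v - item p n (Q n) (fun k => c (w' k)) v) ?_ ?_ v)
      · intro v hv
        exact sub_eq_zero.2 (hUeq v hv _ _ fun i hi => congrArg c (congrFun hside ⟨i, hi⟩))
      · intro t
        simp_rw [sub_mul]
        rw [Finset.sum_sub_distrib, sub_eq_zero]
        exact congrFun (congrFun hans n) t
    · have hcost : S.cost θ H ≤ ∑ _n : Fin N,
          ENNReal.ofReal (Real.logb (Fintype.card A) (Fintype.card (Fin T → ZMod p))) :=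
        Finset.sum_le_sum fun n _ => entropy_le_logb_card hb _
      refine hcost.trans ?_
      have hlogp : 0 ≤ Real.logb (Fintype.card A) p :=
        Real.logb_nonneg (by exact_mod_cast hb) (by exact_mod_cast hp.one_lt.le)
      have e1 : Real.logb (Fintype.card A) (Fintype.card (Fin T → ZMod p))
          = T * Real.logb (Fintype.card A) p := by
        rw [Fintype.card_fun, ZMod.card, Fintype.card_fin, Nat.cast_pow, Real.logb_pow]
      rw [e1, Finset.sum_const, Finset.card_univ, Fintype.card_fin, nsmul_eq_mul,
        ← ENNReal.ofReal_natCast, ← ENNReal.ofReal_natCast, ← ENNReal.ofReal_mul (by positivity),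
        ← ENNReal.ofReal_mul (hr0.trans hd.le)]
      refine ENNReal.ofReal_le_ofReal ?_
      have hℓ' : (0 : ℝ) < Fintype.card ι := by exact_mod_cast hℓ
      have h1 : r ≤ (d - r) * L := by
        have : r / (d - r) ≤ L := (Nat.le_ceil _).trans
          (by exact_mod_cast (le_max_right _ _).trans hL)
        rwa [div_le_iff₀ (by linarith), mul_comm] at this
      have h2 : Real.logb (Fintype.card A) p ≤ (L + 1) / Fintype.card ι := by
        rw [le_div_iff₀ hℓ', mul_comm]
        exact hlog
      calc _ = (N * T : ℝ) * Real.logb (Fintype.card A) p := by ring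
        _ ≤ (N * T : ℝ) * ((L + 1) / Fintype.card ι) := by gcongr
        _ = r * (L + 1) := by rw [hr]; ring
        _ ≤ d * L := by linarith

/-- Each item is a whole message, and parities recover those outside the cache. The scheme for
several databases does not apply: ZMod 1 has no nonzero symbol index. -/
lemma achievable_single_database {K : ℕ} {m : Fin 1 → ℕ} {A : Type} [Fintype A]
    [Nontrivial A] {d : ℝ} (hd : ((K - ∑ n, m n : ℕ) : ℝ) < d) :
    Achievable K m A (ENNReal.ofReal d) := by
  classical
  refine achievable_of_symbol_scheme (Query := fun _ => Unit) (ι := Unit) (V := Fin K)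
    (fun _ _ => PMF.pure fun _ => ()) (fun p _ _ x v => x v ()) (K - ∑ n, m n)
    (fun _ _ _ _ _ _ _ => rfl)
    ?_ ?_ (by simpa using hd)
  · intro p H θ Q _ _ n
    refine ⟨H.allᶜ, ?_, ?_⟩
    · rw [Finset.card_compl, H.card_all, Fintype.card_fin]
    · intro v hv x x' hx
      rw [Finset.mem_compl, not_not] at hv
      rw [hx v hv]
  · intro p H θ Q _ _ x x' h
    funext i
    exact h 0 θ

lemma uniformOfFintype_map_equiv {α β : Type} [Fintype α] [Nonempty α] [Fintype β] [Nonempty β]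
    (e : α ≃ β) : (PMF.uniformOfFintype α).map e = PMF.uniformOfFintype β := by
  classical
  ext y
  rw [PMF.map_apply, tsum_eq_single (e.symm y)]
  · simp [Fintype.card_congr e]
  · intro x hx
    rw [if_neg]
    rintro rfl
    simp at hx

/-- Symbol `j` of instance `v` of a message; the symbols with index `0` are zero. -/
def paddedSymbol {N : ℕ} {F V : Type} [Zero F] (x : V × {j : ZMod N // j ≠ 0} → F) (v : V)
    (j : ZMod N) : F :=
  if h : j = 0 then 0 else x (v, ⟨j, h⟩)

lemma achievable_multiple_databases {N K : ℕ} (hN : 2 ≤ N) {m : Fin N → ℕ} {A : Type} [Fintype A]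
    [Nontrivial A] {d : ℝ}
    (hd : (N * (N ^ K - N ^ (∑ n, m n) : ℕ) : ℝ) / (N ^ K * (N - 1) : ℕ) < d) :
    Achievable K m A (ENNReal.ofReal d) := by
  classical
  have : NeZero N := ⟨by omega⟩
  have : Fact (1 < N) := ⟨by omega⟩
  -- Translation of coordinate θ, as a bijection on permutations: it preserves the uniform law, so
  -- no single query depends on θ in law.
  let shift (θ : Fin K) (n : Fin N) :
      Equiv.Perm (Fin K → ZMod N) ≃ Equiv.Perm (Fin K → ZMod N) :=
    Equiv.equivCongr (Equiv.refl _) (Equiv.addRight (Pi.single θ ((n : ℕ) : ZMod N)))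
  have hshift : ∀ θ n σ v, shift θ n σ v = σ v + Pi.single θ ((n : ℕ) : ZMod N) :=
    fun θ n σ v => rfl
  have : Nonempty {j : ZMod N // j ≠ 0} := ⟨⟨1, one_ne_zero⟩⟩
  refine achievable_of_symbol_scheme (Query := fun _ => Equiv.Perm (Fin K → ZMod N))
    (ι := (Fin K → ZMod N) × {j : ZMod N // j ≠ 0}) (V := Fin K → ZMod N)
    (fun θ _ => (PMF.uniformOfFintype (Equiv.Perm (Fin K → ZMod N))).map fun σ n => shift θ n σ)
    (fun p _ q x v => ∑ k, paddedSymbol (x k) v (q v k)) (N ^ K - N ^ (∑ n, m n)) ?_ ?_ ?_ ?_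
  · intro H H' θ θ' n _ _
    rw [PMF.map_comp, PMF.map_comp]
    exact (uniformOfFintype_map_equiv (shift θ n)).trans
      (uniformOfFintype_map_equiv (shift θ' n)).symm
  · intro p H θ Q _ _ n
    -- A pattern vanishing off the cache involves only cached messages and zero symbols. As `Q n` is
    -- a permutation, such patterns correspond to the functions on `H.all`.
    refine ⟨(Finset.univ.filter fun v => ∀ k ∉ H.all, Q n v k = 0)ᶜ, ?_, ?_⟩
    · rw [Finset.card_compl, Fintype.card_fun, ZMod.card, Fintype.card_fin]
      refine le_of_eq ?_
      congr 1
      rw [← H.card_all]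
      have : (Finset.univ : Finset (H.all → ZMod N)).card = N ^ H.all.card := by
        simp [ZMod.card]
      rw [← this]
      refine Finset.card_bij' (fun v _ i => Q n v i)
        (fun y _ => (Q n).symm fun k => if h : k ∈ H.all then y ⟨k, h⟩ else 0) ?_ ?_ ?_ ?_
      · simp
      · intro y _
        simp only [Finset.mem_filter, Finset.mem_univ, true_and, Equiv.apply_symm_apply]
        intro k hk
        rw [dif_neg hk]
      · intro v hv
        simp only [Finset.mem_filter, Finset.mem_univ, true_and] at hv
        rw [Equiv.symm_apply_eq]
        funext k
        split_ifs with hk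
        · rfl
        · exact (hv k hk).symm
      · intro y _
        funext i
        simp
    · intro v hv x x' hx
      simp only [Finset.mem_compl, Finset.mem_filter, Finset.mem_univ, true_and, not_not] at hv
      refine Finset.sum_congr rfl fun k _ => ?_
      by_cases hk : k ∈ H.all
      · rw [hx k hk]
      · simp [paddedSymbol, hv k hk]
  · intro p H θ Q _ hQ x x' h
    obtain ⟨σ, -, rfl⟩ := (PMF.mem_support_map_iff _ _ _).1 ((PMF.mem_support_iff _ _).2 hQ)
    simp only [hshift] at h
    have hsplit : ∀ (x : Fin K → (Fin K → ZMod N) × {j : ZMod N // j ≠ 0} → ZMod p) (n : Fin N)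
        (v : Fin K → ZMod N),
        ∑ k, paddedSymbol (x k) v ((σ v + (Pi.single θ ((n : ℕ) : ZMod N) : Fin K → ZMod N)) k) =
          paddedSymbol (x θ) v (σ v θ + (n : ℕ)) +
            ∑ k ∈ Finset.univ.erase θ, paddedSymbol (x k) v (σ v k) := by
      intro x n v
      rw [← Finset.add_sum_erase _ _ (Finset.mem_univ θ)]
      congr 1
      · simp
      · refine Finset.sum_congr rfl fun k hk => ?_
        simp [Pi.single_eq_of_ne (Finset.mem_erase.1 hk).1]
    simp only [hsplit] at h
    have hsurj : ∀ a : ZMod N, ∃ n : Fin N, ((n : ℕ) : ZMod N) = a := fun a =>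
      ⟨⟨a.val, ZMod.val_lt a⟩, ZMod.natCast_zmod_val a⟩
    funext ⟨v, j⟩
    -- Database n₀ hits the zero symbol of θ and returns the bare interference; n₁ returns symbol j
    -- plus the same interference.
    obtain ⟨n₀, hn₀⟩ := hsurj (0 - σ v θ)
    obtain ⟨n₁, hn₁⟩ := hsurj (j - σ v θ)
    have h0 := h n₀ v
    have h1 := h n₁ v
    rw [hn₀, add_sub_cancel] at h0
    rw [hn₁, add_sub_cancel] at h1
    simp only [paddedSymbol, dite_true, zero_add, dif_neg j.2] at h0 h1
    simp only [h0] at h1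
    exact add_right_cancel h1
  · refine lt_of_eq_of_lt ?_ hd
    congr 2
    rw [Fintype.card_prod, Fintype.card_fun, ZMod.card, Fintype.card_fin,
      Fintype.card_subtype_compl, ZMod.card, Fintype.card_subtype_eq]

end Achievability

/-! ### Optimal cost and capacity -/

/-- The normalized download cost with `j` messages outside the cache. -/
noncomputable def geomCost (N j : ℕ) : ℝ := ∑ i ∈ Finset.range j, (1 / (N : ℝ)) ^ i

lemma geomCost_pos (N : ℕ) {j : ℕ} (hj : 0 < j) : 0 < geomCost N j := by
  obtain ⟨j, rfl⟩ := Nat.exists_eq_succ_of_ne_zero hj.ne'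
  rw [geomCost, Finset.sum_range_succ']
  positivity

lemma geomCost_mono (N : ℕ) {i j : ℕ} (h : i ≤ j) : geomCost N i ≤ geomCost N j :=
  Finset.sum_le_sum_of_subset_of_nonneg (Finset.range_mono h) fun _ _ _ => by positivity

lemma geomCost_eq {N : ℕ} (hN : 2 ≤ N) (j : ℕ) :
    geomCost N j = (1 - (1 / (N : ℝ)) ^ j) / (1 - 1 / (N : ℝ)) := by
  have : (1 : ℝ) / N ≠ 1 := by
    have : (2 : ℝ) ≤ N := by exact_mod_cast hN
    rw [Ne, div_eq_one_iff_eq (by positivity)]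
    linarith
  rw [geomCost, geom_sum_eq this, ← neg_sub, ← neg_sub (1 : ℝ) (1 / (N : ℝ)), neg_div_neg_eq]

lemma ofReal_geomCost {N : ℕ} (hN : 0 < N) (j : ℕ) :
    ENNReal.ofReal (geomCost N j) = ∑ i ∈ Finset.range j, (N : ℝ≥0∞)⁻¹ ^ i := by
  rw [geomCost, ENNReal.ofReal_sum_of_nonneg fun _ _ => by positivity]
  refine Finset.sum_congr rfl fun i _ => ?_
  rw [ENNReal.ofReal_pow (by positivity), one_div,
    ENNReal.ofReal_inv_of_pos (by exact_mod_cast hN), ENNReal.ofReal_natCast]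

variable {N K : ℕ} {A : Type} [Fintype A] [Nontrivial A] {m : Fin N → ℕ}

lemma ofReal_geomCost_le_of_achievable (hN : 0 < N) (hm : ∑ n, m n < K) {d : ℝ≥0∞}
    (hd : Achievable K m A d) : ENNReal.ofReal (geomCost N (K - ∑ n, m n)) ≤ d := by
  rw [ofReal_geomCost hN]
  exact geom_sum_le_of_achievable hN hm hd

lemma achievable_of_geomCost_lt (hN : 0 < N) (hm : ∑ n, m n < K) {d : ℝ}
    (hd : geomCost N (K - ∑ n, m n) < d) : Achievable K m A (ENNReal.ofReal d) := by
  rcases Nat.lt_or_ge N 2 with h | h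
  · obtain rfl : N = 1 := by omega
    refine achievable_single_database ?_
    simpa [geomCost] using hd
  · refine achievable_multiple_databases h (lt_of_eq_of_lt ?_ hd)
    rw [geomCost_eq h]
    obtain ⟨j, hj⟩ := Nat.exists_eq_add_of_le hm.le
    have h2 : (2 : ℝ) ≤ N := by exact_mod_cast h
    have hN1 : (N : ℝ) - 1 ≠ 0 := by linarith
    have hN0 : (N : ℝ) ≠ 0 := by linarith
    have hle : N ^ (∑ n, m n) ≤ N ^ K := Nat.pow_le_pow_right hN hm.le
    rw [Nat.cast_sub hle, Nat.cast_mul, Nat.cast_sub hN]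
    have e : K - ∑ n, m n = j := by omega
    have e' : (N : ℝ) ^ K = N ^ (∑ n, m n) * N ^ j := by rw [← pow_add, ← hj]
    rw [e]
    push_cast
    rw [e', one_div_pow]
    field_simp

lemma achievable_geomCost_add (hN : 0 < N) (hm : ∑ n, m n < K) {ε : NNReal} (hε : 0 < ε) :
    Achievable K m A (ENNReal.ofReal (geomCost N (K - ∑ n, m n)) + ε) := by
  have h0 := (geomCost_pos N (Nat.sub_pos_of_lt hm)).le
  rw [← ENNReal.ofReal_coe_nnreal, ← ENNReal.ofReal_add h0 ε.coe_nonneg]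
  exact achievable_of_geomCost_lt hN hm (lt_add_of_pos_right _ hε)

lemma optimalCostFor_eq (hN : 0 < N) (hm : ∑ n, m n < K) :
    optimalCostFor K m A = ENNReal.ofReal (geomCost N (K - ∑ n, m n)) :=
  le_antisymm
    (ENNReal.le_of_forall_pos_le_add fun _ hε _ => sInf_le (achievable_geomCost_add hN hm hε))
    (le_sInf fun _ hd => ofReal_geomCost_le_of_achievable hN hm hd)

lemma exists_prefetching_sum_eq (hN : 0 < N) (M : ℕ) : ∃ m : Fin N → ℕ, ∑ n, m n = M :=
  ⟨Pi.single ⟨0, hN⟩ M, by simp⟩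

/-- An underfilled cache leaves more messages outside it, hence a longer geometric sum. -/
lemma ofReal_geomCost_le_of_achievable_of_le {M : ℕ} (hN : 0 < N) (hM : M < K)
    (hm : ∑ n, m n ≤ M) {d : ℝ≥0∞} (hd : Achievable K m A d) :
    ENNReal.ofReal (geomCost N (K - M)) ≤ d :=
  (ENNReal.ofReal_le_ofReal (geomCost_mono N (by omega))).trans
    (ofReal_geomCost_le_of_achievable hN (hm.trans_lt hM) hd)

lemma optimalCost_eq {M : ℕ} (hN : 0 < N) (hM : M < K) :
    optimalCost N K M A = ENNReal.ofReal (geomCost N (K - M)) := by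
  refine le_antisymm (ENNReal.le_of_forall_pos_le_add fun ε hε _ => ?_)
    (le_sInf fun d ⟨m, hm, hd⟩ => ofReal_geomCost_le_of_achievable_of_le hN hM hm hd)
  obtain ⟨m, rfl⟩ := exists_prefetching_sum_eq hN M
  exact sInf_le ⟨m, le_rfl, achievable_geomCost_add hN hM hε⟩

lemma capacity_eq {M : ℕ} (hN : 0 < N) (hM : M < K) :
    capacity N K M A = ENNReal.ofReal (geomCost N (K - M))⁻¹ := by
  rw [ENNReal.ofReal_inv_of_pos (geomCost_pos N (Nat.sub_pos_of_lt hM))]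
  refine le_antisymm (sSup_le fun R ⟨m, hm, hd⟩ => ?_) ?_
  · exact ENNReal.le_inv_iff_le_inv.1 (ofReal_geomCost_le_of_achievable_of_le hN hM hm hd)
  -- The infimum itself is not shown to be achievable, so the rates 1/(D* + ε) are used and ε tends
  -- to 0.
  · rw [ENNReal.inv_le_iff_inv_le]
    refine ENNReal.le_of_forall_pos_le_add fun ε hε _ => ?_
    rw [ENNReal.inv_le_iff_inv_le]
    obtain ⟨m, rfl⟩ := exists_prefetching_sum_eq hN M
    refine le_sSup ⟨m, le_rfl, ?_⟩
    rw [inv_inv]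
    exact achievable_geomCost_add hN hM hε

end SideInfoPIR

theorem theorem1 (N K M : ℕ) (hN : 0 < N) (hM : M < K)
    (A : Type) [Fintype A] [Nontrivial A] :
    SideInfoPIR.optimalCost N K M A
        = ENNReal.ofReal (∑ i ∈ Finset.range (K - M), (1 / (N : ℝ)) ^ i) ∧
      (∀ m : Fin N → ℕ, ∑ n, m n = M →
        SideInfoPIR.optimalCostFor K m A
          = ENNReal.ofReal (∑ i ∈ Finset.range (K - M), (1 / (N : ℝ)) ^ i)) ∧
      SideInfoPIR.capacity N K M A
        = ENNReal.ofReal (∑ i ∈ Finset.range (K - M), (1 / (N : ℝ)) ^ i)⁻¹ ∧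
      (2 ≤ N →
        SideInfoPIR.optimalCost N K M A
            = ENNReal.ofReal ((1 - (1 / (N : ℝ)) ^ (K - M)) / (1 - 1 / (N : ℝ))) ∧
          SideInfoPIR.capacity N K M A
            = ENNReal.ofReal ((1 - 1 / (N : ℝ)) / (1 - (1 / (N : ℝ)) ^ (K - M)))) := by
  refine ⟨SideInfoPIR.optimalCost_eq hN hM, ?_, SideInfoPIR.capacity_eq hN hM, fun h => ⟨?_, ?_⟩⟩
  · rintro m rfl
    exact SideInfoPIR.optimalCostFor_eq hN hM
  · rw [← SideInfoPIR.geomCost_eq h]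
    exact SideInfoPIR.optimalCost_eq hN hM
  · rw [← inv_div, ← SideInfoPIR.geomCost_eq h]
    exact SideInfoPIR.capacity_eq hN hM
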